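/- Let $\Sigma$ be a finite alphabet. A timed word is a finite sequence $(t_1\cdot a_1)\cdots(t_n\cdot a_n)$ with $t_i\in\mathbb{R}_{\ge 0}$, $a_i\in\Sigma$; a timed language is a set $L$ of timed words, and $u^{-1}L=\{w\mid uw\in L\}$. A one-clock timed automaton has a finite state set, an initial state, a set of final states, and finitely many transitions $(q,q',a,\phi,r)$, where $r\in\{0,1\}$ and the guard $\phi$ is a finite non-empty conjunction of constraints $c<x$, $x=c$, $x<c$ with $c\in\mathbb{N}$. From configuration $(q,\nu)$ it reads $(t\cdot a)$ along such a transition if $\nu+t$ satisfies $\phi$, and moves to $(q',(\nu+t)r)$; a word is accepted if some run on it from the initial state with clock value $0$ ends in a final state. The automaton is a 1-DTA if any two distinct transitions with the same source and the same letter have disjoint guards. Its maximum constant is the largest constant occurring in its transitions ($0$ if it has none). $L$ is 1-DTA recognizable if it is accepted by some 1-DTA; then $K_L$ denotes the smallest $K\in\mathbb{N}$ such that some 1-DTA with maximum constant $K$ accepts $L$. For $y,z\in\mathbb{R}_{\ge0}$ write $y\equiv z$ if $\lfloor y\rfloor=\lfloor z\rfloor$ and ($\{y\}=0\Leftrightarrow\{z\}=0$),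 where $\{\cdot\}$ is the fractional part. For $K\in\mathbb{N}\cup\{\infty\}$ write $y\equiv^K z$ if $y\equiv z$ or both $y>K$ and $z>K$. Let $\mathrm{hi}(x)=x$ if $\{x\}=0$ and $\mathrm{hi}(x)=\lfloor x\rfloor+\frac12$ otherwise. A timed word is half-integral if all its delays are of the form $\frac m2$, $m\in\mathbb{N}$; let $\mathcal{HI}$ be the set of half-integral words. A reset function is a map $R$ from timed words to $\mathbb{R}_{\ge0}$ with $R(\epsilon)=0$ and $R(u(t\cdot a))\in\{0,R(u)+t\}$ for all $u,t,a$. Its normal form map is given by $N^R(\epsilon)=\epsilon$ and $N^R(u(t\cdot a))=N^R(u)(t'\cdot a)$, where $t'$ is the unique delay of the form $\frac n2$, $n\in\mathbb{N}$, with $R(u)+t\equiv \mathrm{hi}(R(u))+t'$. A profile is a pair $(R,\approx)$ of a reset function and an equivalence relation on $\mathcal{HI}$. Let $K_{(R,\approx)}\in\mathbb{N}\cup\{\infty\}$ be the least $K\in\mathbb{N}$ such that for all $u\in\mathcal{HI}$, $a\in\Sigma$, $n\in\mathbb{N}$, $R(u)+\frac n2>K$ implies $u(\frac n2\cdot a)\approx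 u((K+\frac12)\cdot a)$, and $\infty$ if there is no such $K$. The profile - is $L$-preserving if for all $u,v\in\mathcal{HI}$, $u\approx v$ implies ($u\in L\Leftrightarrow v\in L$), and for every timed word $w$, $w\in L\Leftrightarrow N^R(w)\in L$; - has finite index if $\approx$ has finitely many classes and $K_{(R,\approx)}<\infty$; - is monotonic if for all $u,v\in\mathcal{HI}$, $u\approx v$ implies (a) $R(u)\equiv^{K_{(R,\approx)}}R(v)$ and (b) $u(\frac n2\cdot a)\approx v(\frac n2\cdot a)$ for all $n\in\mathbb{N}$, $a\in\Sigma$; and (c) $R(w)\equiv R(N^R(w))$ for every timed word $w$. The syntactic reset function of $L$ is defined by $\mathbf{R}^L(\epsilon)=0$, and $\mathbf{R}^L(u(t\cdot a))=0$ if $(u(t\cdot a))^{-1}L$ is 1-DTA recognizable, $\mathbf{R}^L(u(t\cdot a))=\mathbf{R}^L(u)+t$ otherwise. The syntactic profile of $L$ is $(\mathbf{R}^L,\approx^L)$, where for $u,v\in\mathcal{HI}$, $u\approx^L v$ iff $\mathbf{R}^L(u)=\mathbf{R}^L(v)$ and $u^{-1}L=v^{-1}L$. **Proposition.** If $L$ is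 1-DTA recognizable, then $(\mathbf{R}^L,\approx^L)$ is $L$-preserving, monotonic and of finite index, and $K_{(\mathbf{R}^L,\approx^L)}=K_L$. -/

import Mathlib

open scoped NNReal

namespace OneClock

universe u

/-! ### Timed words, timed languages, residuals -/

/-- A timed word `(t₁·a₁)⋯(tₙ·aₙ)`: a finite sequence of (delay, letter) pairs. -/
abbrev TimedWord (α : Type u) : Type u := List (ℝ≥0 × α)

/-- A timed language. -/
abbrev TimedLanguage (α : Type u) : Type u := Set (TimedWord α)

/-- The residual language `u⁻¹L = {w | uw ∈ L}`. -/
def residual {α : Type u} (u : TimedWord α) (L : TimedLanguage α) : TimedLanguage α :=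
  {w | u ++ w ∈ L}

/-! ### One-clock timed automata -/

/-- Clock constraints `φ ::= c < x | x = c | x < c | φ ∧ φ` with `c ∈ ℕ`. -/
inductive ClockConstraint : Type where
  | gt (c : ℕ) : ClockConstraint
  | eq (c : ℕ) : ClockConstraint
  | lt (c : ℕ) : ClockConstraint
  | and (φ ψ : ClockConstraint) : ClockConstraint

/-- The set `⟦φ⟧` of clock values satisfying `φ`. -/
def ClockConstraint.denote : ClockConstraint → Set ℝ≥0
  | .gt c => {x | (c : ℝ≥0) < x}
  | .eq c => {x | x = (c : ℝ≥0)}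
  | .lt c => {x | x < (c : ℝ≥0)}
  | .and φ ψ => φ.denote ∩ ψ.denote

/-- The largest constant occurring in a clock constraint. -/
def ClockConstraint.maxConst : ClockConstraint → ℕ
  | .gt c => c
  | .eq c => c
  | .lt c => c
  | .and φ ψ => max φ.maxConst ψ.maxConst

/-- A transition `(q, q', a, φ, r)`; `reset = true` encodes `r = 0` (the clock is reset) and
`reset = false` encodes `r = 1` (the clock is not reset). -/
structure Transition (α : Type u) (Q : Type) : Type u where
  source : Q
  target : Q
  letter : α
  guard : ClockConstraint
  reset : Bool

/-- A one-clock timed automaton over the alphabet `α`. -/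
structure OneTA (α : Type u) : Type (max u 1) where
  State : Type
  finite_state : Finite State
  init : State
  trans : Finset (Transition α State)
  final : Set State

namespace OneTA

variable {α : Type u}

/-- Two distinct transitions with the same source and the same letter have disjoint guards. -/
def Deterministic (A : OneTA α) : Prop :=
  ∀ θ ∈ A.trans, ∀ θ' ∈ A.trans, θ ≠ θ' →
    θ.source ≠ θ'.source ∨ θ.letter ≠ θ'.letter ∨ θ.guard.denote ∩ θ'.guard.denote = ∅

/-- The maximum constant of the automaton: the largest constant occurring in its transitions
(`0` if there is no transition). -/
def maxConst (A : OneTA α) : ℕ := A.trans.sup fun θ => θ.guard.maxConst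

/-- `A.Reaches q ν w q' ν'`: there is a run on `w` from the configuration `(q, ν)` to the
configuration `(q', ν')`. -/
def Reaches (A : OneTA α) : A.State → ℝ≥0 → TimedWord α → A.State → ℝ≥0 → Prop
  | q, ν, [], q', ν' => q = q' ∧ ν = ν'
  | q, ν, (t, a) :: w, q', ν' => ∃ θ ∈ A.trans, θ.source = q ∧ θ.letter = a ∧
      ν + t ∈ θ.guard.denote ∧
      Reaches A θ.target (if θ.reset then 0 else ν + t) w q' ν'

/-- The language accepted from a configuration. -/
def languageFrom (A : OneTA α) (q : A.State) (ν : ℝ≥0) : TimedLanguage α :=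
  {w | ∃ q' ν', A.Reaches q ν w q' ν' ∧ q' ∈ A.final}

/-- The language of the automaton. -/
def language (A : OneTA α) : TimedLanguage α := A.languageFrom A.init 0

end OneTA

/-- `L` is the language of some deterministic one-clock timed automaton. -/
def IsRecognizable {α : Type u} (L : TimedLanguage α) : Prop :=
  ∃ A : OneTA α, A.Deterministic ∧ A.language = L

/-- `K_L`: the smallest `K` such that some deterministic one-clock timed automaton with maximum
constant `K` accepts `L` (only meaningful when `L` is recognizable; then the minimum exists). -/
noncomputable def minConstant {α : Type u} (L : TimedLanguage α) : ℕ :=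
  sInf {K : ℕ | ∃ A : OneTA α, A.Deterministic ∧ A.maxConst = K ∧ A.language = L}

/-! ### Regions -/

/-- The fractional part. -/
noncomputable def frac (y : ℝ≥0) : ℝ≥0 := y - (⌊y⌋₊ : ℝ≥0)

/-- Region equivalence `y ≡ z`. -/
def RegionEquiv (y z : ℝ≥0) : Prop :=
  ⌊y⌋₊ = ⌊z⌋₊ ∧ (frac y = 0 ↔ frac z = 0)

/-- Region equivalence `y ≡^K z` with respect to a constant `K ∈ ℕ ∪ {∞}`; for `K = ∞` it is
`y ≡ z`. -/
def RegionEquivUpTo (K : ℕ∞) (y z : ℝ≥0) : Prop :=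
  RegionEquiv y z ∨ ∃ k : ℕ, K = (k : ℕ∞) ∧ (k : ℝ≥0) < y ∧ (k : ℝ≥0) < z

open Classical in
/-- The half-integral representative of the region of `x`. -/
noncomputable def hi (x : ℝ≥0) : ℝ≥0 :=
  if frac x = 0 then x else (⌊x⌋₊ : ℝ≥0) + 1 / 2

/-! ### Reset functions -/

/-- `R` is a reset function. -/
def IsResetFunction {α : Type u} (R : TimedWord α → ℝ≥0) : Prop :=
  R [] = 0 ∧ ∀ (u : TimedWord α) (t : ℝ≥0) (a : α),
    R (u ++ [(t, a)]) = 0 ∨ R (u ++ [(t, a)]) = R u + t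

open Classical in
/-- The syntactic reset function `R^L`, defined prefix by prefix. -/
noncomputable def syntacticReset {α : Type u} (L : TimedLanguage α) (w : TimedWord α) : ℝ≥0 :=
  List.reverseRecOn (motive := fun _ => ℝ≥0) w 0 fun u x r =>
    if IsRecognizable (residual (u ++ [x]) L) then 0 else r + x.1

theorem syntacticReset_nil {α : Type u} (L : TimedLanguage α) : syntacticReset L [] = 0 := by
  simp [syntacticReset]

open Classical in
theorem syntacticReset_snoc {α : Type u} (L : TimedLanguage α) (u : TimedWord α) (t : ℝ≥0)
    (a : α) : syntacticReset L (u ++ [(t, a)]) =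
      if IsRecognizable (residual (u ++ [(t, a)]) L) then 0 else syntacticReset L u + t := by
  simp [syntacticReset]

theorem syntacticReset_isResetFunction {α : Type u} (L : TimedLanguage α) :
    IsResetFunction (syntacticReset L) := by
  refine ⟨syntacticReset_nil L, fun u t a => ?_⟩
  rw [syntacticReset_snoc]
  split_ifs
  · exact Or.inl rfl
  · exact Or.inr rfl

/-- The normal form `N^R`: `N^R(ε) = ε` and `N^R(u(t·a)) = N^R(u)(t'·a)` where `t'` is the unique
half-integral delay with `R(u) + t ≡ hi(R(u)) + t'`, that is `t' = hi(R(u) + t) - hi(R(u))`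
(see `normalForm_delay_spec` and `normalForm_delay_unique`). -/
noncomputable def normalForm {α : Type u} (R : TimedWord α → ℝ≥0) (w : TimedWord α) :
    TimedWord α :=
  List.reverseRecOn (motive := fun _ => TimedWord α) w [] fun u x v =>
    v ++ [(hi (R u + x.1) - hi (R u), x.2)]

theorem normalForm_nil {α : Type u} (R : TimedWord α → ℝ≥0) : normalForm R [] = [] := by
  simp [normalForm]

theorem normalForm_snoc {α : Type u} (R : TimedWord α → ℝ≥0) (u : TimedWord α) (t : ℝ≥0)
    (a : α) : normalForm R (u ++ [(t, a)]) =
      normalForm R u ++ [(hi (R u + t) - hi (R u), a)] := by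
  simp [normalForm]

/-! ### Half-integral words and profiles -/

/-- Every delay is of the form `m / 2` with `m ∈ ℕ`. -/
def IsHalfIntegral {α : Type u} (w : TimedWord α) : Prop :=
  ∀ x ∈ w, ∃ m : ℕ, x.1 = (m : ℝ≥0) / 2

/-- The set of half-integral words. -/
abbrev HIWord (α : Type u) : Type u := {w : TimedWord α // IsHalfIntegral w}

/-- The half-integral word `u (n/2 · a)`. -/
noncomputable def HIWord.snoc {α : Type u} (w : HIWord α) (n : ℕ) (a : α) : HIWord α :=
  ⟨w.1 ++ [((n : ℝ≥0) / 2, a)], by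
    intro x hx
    rcases List.mem_append.1 hx with h | h
    · exact w.2 x h
    · exact ⟨n, by rw [List.mem_singleton.1 h]⟩⟩

/-- A profile `(R, ≈)`: a reset function and an equivalence relation on half-integral words. -/
structure Profile (α : Type u) : Type u where
  R : TimedWord α → ℝ≥0
  isReset : IsResetFunction R
  equiv : Setoid (HIWord α)

namespace Profile

variable {α : Type u}

/-- The proposition `C(K)`: if `R(u) + n/2 > K` then `u (n/2 · a) ≈ u (K + 1/2 · a)`
(note `K + 1/2 = (2K + 1)/2`). -/
def C (P : Profile α) (K : ℕ) : Prop :=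
  ∀ (w : HIWord α) (a : α) (n : ℕ), (K : ℝ≥0) < P.R w.1 + (n : ℝ≥0) / 2 →
    P.equiv (w.snoc n a) (w.snoc (2 * K + 1) a)

/-- The constant `K_(R,≈) ∈ ℕ ∪ {∞}`: the least `K` with `C(K)`, and `∞` if there is none. -/
noncomputable def constant (P : Profile α) : ℕ∞ := ⨅ K ∈ {K : ℕ | P.C K}, (K : ℕ∞)

/-- `L`-preserving profiles. -/
def Preserves (P : Profile α) (L : TimedLanguage α) : Prop :=
  (∀ v w : HIWord α, P.equiv v w → (v.1 ∈ L ↔ w.1 ∈ L)) ∧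
    ∀ w : TimedWord α, w ∈ L ↔ normalForm P.R w ∈ L

/-- Finite index: `≈` has finitely many classes and `K_(R,≈) < ∞`. -/
def FiniteIndex (P : Profile α) : Prop :=
  Finite (Quotient P.equiv) ∧ P.constant < ⊤

/-- Monotonic profiles. -/
def Monotonic (P : Profile α) : Prop :=
  (∀ v w : HIWord α, P.equiv v w →
    RegionEquivUpTo P.constant (P.R v.1) (P.R w.1) ∧
      ∀ (n : ℕ) (a : α), P.equiv (v.snoc n a) (w.snoc n a)) ∧
    ∀ w : TimedWord α, RegionEquiv (P.R w) (P.R (normalForm P.R w))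

end Profile

/-- The syntactic profile `(R^L, ≈^L)`: half-integral words are equivalent when they have the same
value under `R^L` and the same residual language. -/
noncomputable def syntacticProfile {α : Type u} (L : TimedLanguage α) : Profile α where
  R := syntacticReset L
  isReset := syntacticReset_isResetFunction L
  equiv :=
    { r := fun v w => syntacticReset L v.1 = syntacticReset L w.1 ∧
        residual v.1 L = residual w.1 L
      iseqv :=
        ⟨fun _ => ⟨rfl, rfl⟩, fun h => ⟨h.1.symm, h.2.symm⟩,
          fun h h' => ⟨h.1.trans h'.1, h.2.trans h'.2⟩⟩ }

/-! ### The delays of the normal form are the intended ones -/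

theorem frac_eq_zero_iff (x : ℝ≥0) : frac x = 0 ↔ x = (⌊x⌋₊ : ℝ≥0) := by
  unfold frac
  rw [tsub_eq_zero_iff_le]
  exact ⟨fun h => le_antisymm h (Nat.floor_le (zero_le (a := x))), fun h => h.le⟩

theorem hi_half_integral (x : ℝ≥0) : ∃ m : ℕ, hi x = (m : ℝ≥0) / 2 := by
  unfold hi
  split_ifs with h
  · refine ⟨2 * ⌊x⌋₊, ?_⟩
    rw [frac_eq_zero_iff] at h
    push_cast
    rw [← h]
    field_simp
  · refine ⟨2 * ⌊x⌋₊ + 1, ?_⟩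
    push_cast
    field_simp

theorem half_floor (n : ℕ) : ⌊(n : ℝ≥0) + 1 / 2⌋₊ = n := by
  rw [Nat.floor_eq_iff zero_le]
  constructor
  · exact le_self_add
  · gcongr
    rw [← NNReal.coe_lt_coe]
    push_cast
    norm_num

theorem hi_regionEquiv (x : ℝ≥0) : RegionEquiv x (hi x) := by
  unfold hi
  split_ifs with h
  · exact ⟨rfl, Iff.rfl⟩
  · refine ⟨(half_floor _).symm, ?_⟩
    refine iff_of_false h ?_
    rw [frac_eq_zero_iff, half_floor]
    simp

theorem hi_mono {x y : ℝ≥0} (hxy : x ≤ y) : hi x ≤ hi y := by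
  have hf : (⌊x⌋₊ : ℝ≥0) ≤ (⌊y⌋₊ : ℝ≥0) := by exact_mod_cast Nat.floor_mono hxy
  unfold hi
  split_ifs with h h' h'
  · exact hxy
  · rw [frac_eq_zero_iff] at h
    rw [h]
    exact hf.trans le_self_add
  · rw [frac_eq_zero_iff] at h h'
    have hlt : ⌊x⌋₊ < ⌊y⌋₊ := by
      rcases (Nat.floor_mono hxy).lt_or_eq with h1 | h1
      · exact h1
      · exfalso
        apply h
        apply le_antisymm _ (Nat.floor_le (zero_le (a := x)))
        rw [h1, ← h']
        exact hxy
    have h2 : (⌊x⌋₊ : ℝ≥0) + 1 ≤ (⌊y⌋₊ : ℝ≥0) := by exact_mod_cast hlt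
    rw [h']
    refine le_trans ?_ h2
    gcongr
    rw [← NNReal.coe_le_coe]
    push_cast
    norm_num
  · gcongr

/-- Two half-integral values in the same region are equal. -/
theorem half_integral_eq_of_regionEquiv {m n : ℕ}
    (h : RegionEquiv ((m : ℝ≥0) / 2) ((n : ℝ≥0) / 2)) : m = n := by
  obtain ⟨h1, h2⟩ := h
  have key : ∀ k : ℕ, ⌊(k : ℝ≥0) / 2⌋₊ = k / 2 := fun k => by
    have := Nat.floor_div_natCast (k : ℝ≥0) 2
    simpa using this
  have key2 : ∀ k : ℕ, frac ((k : ℝ≥0) / 2) = 0 ↔ k % 2 = 0 := fun k => by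
    rw [frac_eq_zero_iff, key, div_eq_iff (by norm_num)]
    constructor
    · intro h
      have : k = k / 2 * 2 := by exact_mod_cast h
      omega
    · intro h
      have : k = k / 2 * 2 := by omega
      exact_mod_cast this
  rw [key, key] at h1
  rw [key2, key2] at h2
  omega

/-- The delay used in `normalForm` is half-integral and satisfies the defining condition. -/
theorem normalForm_delay_spec (r t : ℝ≥0) :
    (∃ n : ℕ, hi (r + t) - hi r = (n : ℝ≥0) / 2) ∧
      RegionEquiv (r + t) (hi r + (hi (r + t) - hi r)) := by
  constructor
  · obtain ⟨m, hm⟩ := hi_half_integral r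
    obtain ⟨k, hk⟩ := hi_half_integral (r + t)
    have hle : m ≤ k := by
      have h := hi_mono (le_self_add : r ≤ r + t)
      rw [hm, hk] at h
      have h2 : (m : ℝ≥0) ≤ k := by
        rwa [div_le_div_iff_of_pos_right (by norm_num : (0 : ℝ≥0) < 2)] at h
      exact_mod_cast h2
    refine ⟨k - m, ?_⟩
    obtain ⟨d, rfl⟩ := Nat.exists_eq_add_of_le hle
    rw [hk, hm, Nat.add_sub_cancel_left]
    push_cast
    rw [add_div, add_tsub_cancel_left]
  · rw [add_tsub_cancel_of_le (hi_mono le_self_add)]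
    exact hi_regionEquiv _

/-- The delay used in `normalForm` is the only half-integral one satisfying the condition. -/
theorem normalForm_delay_unique (r t : ℝ≥0) (n : ℕ)
    (h : RegionEquiv (r + t) (hi r + (n : ℝ≥0) / 2)) :
    (n : ℝ≥0) / 2 = hi (r + t) - hi r := by
  obtain ⟨m, hm⟩ := hi_half_integral r
  obtain ⟨k, hk⟩ := hi_half_integral (r + t)
  have h0 := hi_regionEquiv (r + t)
  have h1 : RegionEquiv (((m + n : ℕ) : ℝ≥0) / 2) ((k : ℝ≥0) / 2) := by
    rw [← hk, Nat.cast_add, add_div, ← hm]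
    exact ⟨h.1.symm.trans h0.1, h.2.symm.trans h0.2⟩
  have h2 := half_integral_eq_of_regionEquiv h1
  rw [hk, ← h2, hm, Nat.cast_add, add_div, add_tsub_cancel_left]

end OneClock

open scoped NNReal

namespace OneClock

universe u

/-! ### Indexing regions by natural numbers -/

/-! The heart of the matter is region invariance: if the language accepted from a configuration `(q,
x)` of a deterministic automaton `A` is itself recognized by some `B` started at clock value 0, it
is unchanged when `x` moves within its region. Choose an increasing map of the time axis that
commutes with the shift by 1, fixes the present moment, and sends the last reset of a clock of value
`x'` to that of a clock of value `x`. Warping the delays of a word preserves the behaviour both of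
`A`, passing from `x'` to `x`, and of `B`, started at 0. Since `A` from `x` and `B` agree on the
warped word, `A` from `x'` and `B` agree on the original one.

Hence a word and its normal form have residuals that are recognizable together, and equal when they
are. By induction both are accepted from one state of one automaton, at clock values `R(w)` and `hi
(R(w))`; this yields preservation and monotonicity.

For the constants, beyond its maximum constant `A` can no longer see its clock until the next reset,
so the residual there is recognizable and the syntactic reset function is 0. Moreover `R(w)` never
exceeds the clock of `A`, which resets no more often. So `≈` has finite index and `C` holds for the
maximum constant of every deterministic automaton for `L`. Conversely, `C(K)` turns the classes of
`≈` into the states of an automaton for `L` whose clock is exactly `R` and whose constants are at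
most `K`. -/

open Classical in
/-- The index of the region of `x`: the region `{c}` has index `2c` and the region `(c, c + 1)` has
index `2c + 1`. -/
noncomputable def regionIndex (x : ℝ≥0) : ℕ := 2 * ⌊x⌋₊ + if frac x = 0 then 0 else 1

theorem natCast_lt_iff_regionIndex (c : ℕ) (x : ℝ≥0) :
    (c : ℝ≥0) < x ↔ 2 * c < regionIndex x := by
  unfold regionIndex
  split_ifs with h
  · rw [frac_eq_zero_iff] at h
    conv_lhs => rw [h]
    rw [Nat.cast_lt]
    omega
  · have h' : (⌊x⌋₊ : ℝ≥0) < x := by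
      refine lt_of_le_of_ne (Nat.floor_le zero_le) fun e => h ?_
      rw [frac_eq_zero_iff]
      exact e.symm
    have h1 : c ≤ ⌊x⌋₊ ↔ 2 * c < 2 * ⌊x⌋₊ + 1 := by omega
    rw [← h1]
    refine ⟨fun hc => Nat.le_floor hc.le, fun hc => lt_of_le_of_lt ?_ h'⟩
    exact_mod_cast hc

theorem lt_natCast_iff_regionIndex (c : ℕ) (x : ℝ≥0) :
    x < (c : ℝ≥0) ↔ regionIndex x < 2 * c := by
  rw [← Nat.floor_lt zero_le]
  unfold regionIndex
  split_ifs <;> omega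

theorem eq_natCast_iff_regionIndex (c : ℕ) (x : ℝ≥0) :
    x = (c : ℝ≥0) ↔ regionIndex x = 2 * c := by
  have h1 := natCast_lt_iff_regionIndex c x
  have h2 := lt_natCast_iff_regionIndex c x
  constructor
  · rintro rfl
    simp only [lt_self_iff_false, false_iff] at h1 h2
    omega
  · intro h
    refine le_antisymm (not_lt.1 fun h' => ?_) (not_lt.1 fun h' => ?_)
    · have := h1.1 h'
      omega
    · have := h2.1 h'
      omega

theorem regionEquiv_iff_regionIndex {x y : ℝ≥0} :
    RegionEquiv x y ↔ regionIndex x = regionIndex y := by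
  unfold RegionEquiv regionIndex
  by_cases h : frac x = 0 <;> by_cases h' : frac y = 0 <;> simp [h, h'] <;> omega

theorem hi_eq_regionIndex (x : ℝ≥0) : hi x = (regionIndex x : ℝ≥0) / 2 := by
  unfold hi regionIndex
  split_ifs with h
  · rw [frac_eq_zero_iff] at h
    conv_lhs => rw [h]
    push_cast
    field_simp
    simp
  · push_cast
    field_simp

theorem regionIndex_half (m : ℕ) : regionIndex ((m : ℝ≥0) / 2) = m := by
  have h := hi_regionEquiv ((m : ℝ≥0) / 2)
  rw [hi_eq_regionIndex] at h
  exact (half_integral_eq_of_regionEquiv h).symm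

theorem regionIndex_hi (x : ℝ≥0) : regionIndex (hi x) = regionIndex x := by
  rw [hi_eq_regionIndex, regionIndex_half]

theorem regionIndex_zero : regionIndex 0 = 0 := by
  have := regionIndex_half 0
  simpa using this

theorem eq_zero_of_regionIndex {x : ℝ≥0} (h : regionIndex x = 0) : x = 0 := by
  have := (eq_natCast_iff_regionIndex 0 x).2 (by simpa using h)
  simpa using this

theorem hi_zero : hi 0 = 0 := by
  rw [hi_eq_regionIndex, regionIndex_zero]
  simp

theorem regionIndex_eq_of_lt_iff {x y : ℝ≥0} (h₁ : ∀ c : ℕ, (c : ℝ≥0) < x ↔ (c : ℝ≥0) < y)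
    (h₂ : ∀ c : ℕ, x < (c : ℝ≥0) ↔ y < (c : ℝ≥0)) : regionIndex x = regionIndex y := by
  simp only [natCast_lt_iff_regionIndex, lt_natCast_iff_regionIndex] at h₁ h₂
  have a := h₁ (regionIndex x / 2)
  have b := h₂ (regionIndex x / 2)
  have c := h₂ (regionIndex x / 2 + 1)
  omega

/-- Guards with constants up to `K` see only the index truncated at `2 * K + 1`, which merges all
regions above `K`. -/
theorem ClockConstraint.mem_denote_congr {K : ℕ} {x y : ℝ≥0}
    (h : min (regionIndex x) (2 * K + 1) = min (regionIndex y) (2 * K + 1))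
    (φ : ClockConstraint) (hφ : φ.maxConst ≤ K) : x ∈ φ.denote ↔ y ∈ φ.denote := by
  induction φ with
  | gt c =>
    simp only [denote, maxConst, Set.mem_ofPred_eq, natCast_lt_iff_regionIndex] at *
    omega
  | eq c =>
    simp only [denote, maxConst, Set.mem_ofPred_eq, eq_natCast_iff_regionIndex] at *
    omega
  | lt c =>
    simp only [denote, maxConst, Set.mem_ofPred_eq, lt_natCast_iff_regionIndex] at *
    omega
  | and φ ψ h₁ h₂ =>
    simp only [maxConst, max_le_iff] at hφ
    simp only [denote, Set.mem_inter_iff, h₁ hφ.1, h₂ hφ.2]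

theorem min_regionIndex_of_lt {K : ℕ} {x : ℝ≥0} (h : (K : ℝ≥0) < x) :
    min (regionIndex x) (2 * K + 1) = 2 * K + 1 := by
  rw [natCast_lt_iff_regionIndex] at h
  omega

/-- The guard defining the region of index `i`, where the index `2 * K + 1` stands for all the
values above `K`. -/
def regionGuard (K i : ℕ) : ClockConstraint :=
  if i = 2 * K + 1 then .gt K
  else if i % 2 = 0 then .eq (i / 2) else .and (.gt (i / 2)) (.lt (i / 2 + 1))

theorem mem_denote_regionGuard {K i : ℕ} (hi : i < 2 * K + 2) (x : ℝ≥0) :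
    x ∈ (regionGuard K i).denote ↔ min (regionIndex x) (2 * K + 1) = i := by
  unfold regionGuard
  split_ifs <;>
    simp only [ClockConstraint.denote, Set.mem_ofPred_eq, Set.mem_inter_iff,
      natCast_lt_iff_regionIndex, lt_natCast_iff_regionIndex, eq_natCast_iff_regionIndex] <;>
    omega

theorem maxConst_regionGuard {K i : ℕ} (hi : i < 2 * K + 2) : (regionGuard K i).maxConst ≤ K := by
  unfold regionGuard
  split_ifs <;> simp only [ClockConstraint.maxConst] <;> omega

/-! ### Automata as step functions -/

namespace OneTA

variable {α : Type u} (A : OneTA α)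

theorem guard_maxConst_le {A : OneTA α} {θ : Transition α A.State} (h : θ ∈ A.trans) :
    θ.guard.maxConst ≤ A.maxConst :=
  Finset.le_sup (f := fun θ : Transition α A.State => θ.guard.maxConst) h

/-- The language accepted from a configuration, where `none` stands for a rejecting sink. -/
def optLanguage : Option A.State → ℝ≥0 → TimedLanguage α
  | none, _ => ∅
  | some q, ν => A.languageFrom q ν

/-- The transitions reading `a` that are enabled in the state `q` at the clock value `x`. -/
def enabled (q : A.State) (a : α) (x : ℝ≥0) : Set (Transition α A.State) :=
  {θ | θ ∈ A.trans ∧ θ.source = q ∧ θ.letter = a ∧ x ∈ θ.guard.denote}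

open Classical in
/-- The target state and the reset flag of a transition in a given set, by default the sink with
a reset. -/
noncomputable def outcome {Q : Type} (T : Set (Transition α Q)) : Option Q × Bool :=
  if h : T.Nonempty then (some h.choose.target, h.choose.reset) else (none, true)

/-- The target state and the reset flag of the step that reads `a` at the clock value `x`. -/
noncomputable def next : Option A.State → α → ℝ≥0 → Option A.State × Bool
  | none, _, _ => (none, true)
  | some q, a, x => outcome (A.enabled q a x)

variable {A}

theorem nil_mem_languageFrom (q : A.State) (ν : ℝ≥0) : [] ∈ A.languageFrom q ν ↔ q ∈ A.final := by
  simp [languageFrom, Reaches]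

theorem cons_mem_languageFrom (q : A.State) (ν t : ℝ≥0) (a : α) (w : TimedWord α) :
    (t, a) :: w ∈ A.languageFrom q ν ↔ ∃ θ ∈ A.enabled q a (ν + t),
      w ∈ A.languageFrom θ.target (if θ.reset then 0 else ν + t) := by
  simp only [languageFrom, Reaches, enabled, Set.mem_ofPred_eq]
  constructor
  · rintro ⟨q', ν', ⟨θ, h1, h2, h3, h4, h5⟩, hf⟩
    exact ⟨θ, ⟨h1, h2, h3, h4⟩, q', ν', h5, hf⟩
  · rintro ⟨θ, ⟨h1, h2, h3, h4⟩, q', ν', h5, hf⟩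
    exact ⟨q', ν', ⟨θ, h1, h2, h3, h4, h5⟩, hf⟩

theorem nil_mem_optLanguage (q : Option A.State) (ν ν' : ℝ≥0) :
    [] ∈ A.optLanguage q ν ↔ [] ∈ A.optLanguage q ν' := by
  cases q with
  | none => rfl
  | some q => simp only [optLanguage, nil_mem_languageFrom]

theorem Deterministic.enabled_subsingleton (hA : A.Deterministic) (q : A.State) (a : α)
    (x : ℝ≥0) : (A.enabled q a x).Subsingleton := by
  rintro θ ⟨h1, h2, h3, h4⟩ θ' ⟨h1', h2', h3', h4'⟩
  by_contra hne
  rcases hA θ h1 θ' h1' hne with h | h | h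
  · exact h (h2.trans h2'.symm)
  · exact h (h3.trans h3'.symm)
  · exact (h.subset ⟨h4, h4'⟩ : x ∈ (∅ : Set ℝ≥0))

theorem Deterministic.cons_mem_optLanguage (hA : A.Deterministic) (q : Option A.State)
    (ν t : ℝ≥0) (a : α) (w : TimedWord α) :
    (t, a) :: w ∈ A.optLanguage q ν ↔
      w ∈ A.optLanguage (A.next q a (ν + t)).1 (if (A.next q a (ν + t)).2 then 0 else ν + t) := by
  cases q with
  | none => rfl
  | some q =>
    simp only [next, outcome]
    split_ifs with h
    all_goals first
      | (simp only [optLanguage, cons_mem_languageFrom]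
         constructor
         · rintro ⟨θ, hθ, hw⟩
           rw [hA.enabled_subsingleton _ _ _ hθ h.choose_spec] at hw
           simp_all
         · intro hw
           refine ⟨_, h.choose_spec, ?_⟩
           simp_all)
      | (simp only [optLanguage, cons_mem_languageFrom]
         constructor
         · rintro ⟨θ, hθ, hw⟩
           exact absurd ⟨θ, hθ⟩ h
         · exact fun hw => hw.elim)

theorem next_congr {K : ℕ} (hK : A.maxConst ≤ K) {x y : ℝ≥0}
    (h : min (regionIndex x) (2 * K + 1) = min (regionIndex y) (2 * K + 1))
    (q : Option A.State) (a : α) : A.next q a x = A.next q a y := by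
  cases q with
  | none => rfl
  | some q =>
    have : A.enabled q a x = A.enabled q a y := by
      ext θ
      simp only [enabled, Set.mem_ofPred_eq]
      refine and_congr_right fun hθ => and_congr_right fun _ => and_congr_right fun _ => ?_
      exact θ.guard.mem_denote_congr h ((guard_maxConst_le hθ).trans hK)
    simp only [next, this]

theorem next_congr_of_regionIndex_eq {x y : ℝ≥0} (h : regionIndex x = regionIndex y)
    (q : Option A.State) (a : α) : A.next q a x = A.next q a y :=
  next_congr le_rfl (by rw [h]) q a

theorem Deterministic.residual_snoc (hA : A.Deterministic) {L : TimedLanguage α}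
    {w : TimedWord α} {q : Option A.State} {ν : ℝ≥0} (h : residual w L = A.optLanguage q ν)
    (t : ℝ≥0) (a : α) : residual (w ++ [(t, a)]) L =
      A.optLanguage (A.next q a (ν + t)).1 (if (A.next q a (ν + t)).2 then 0 else ν + t) := by
  ext v
  rw [← hA.cons_mem_optLanguage, ← h]
  simp [residual]

theorem Deterministic.isRecognizable_optLanguage_zero (hA : A.Deterministic)
    (q : Option A.State) : IsRecognizable (A.optLanguage q 0) := by
  cases q with
  | none =>
    refine ⟨⟨Unit, inferInstance, (), ∅, ∅⟩, ?_, ?_⟩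
    · intro θ hθ
      simp at hθ
    · ext w
      simp [optLanguage, language, languageFrom]
  | some q =>
    refine ⟨⟨A.State, A.finite_state, q, A.trans, A.final⟩, hA, ?_⟩
    have h : ∀ (w : TimedWord α) (p p' : A.State) (ν ν' : ℝ≥0),
        Reaches ⟨A.State, A.finite_state, q, A.trans, A.final⟩ p ν w p' ν' ↔
          A.Reaches p ν w p' ν' := by
      intro w
      induction w with
      | nil => exact fun _ _ _ _ => Iff.rfl
      | cons x w ih =>
        intro p p' ν ν'
        simp only [Reaches, ih]
    simp only [optLanguage, language, languageFrom, h]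

/-! ### Deterministic automata defined by a step function on regions -/

section Region

variable [Finite α] {S : Type} [Finite S] (K : ℕ) (δ : S → α → ℕ → S × Bool) (F : Set S)

/-- The transition of `regionAutomaton` from `s` reading `a` in the region of index `i`. -/
def regionTransition (i : S × α × Fin (2 * K + 2)) : Transition α S :=
  ⟨i.1, (δ i.1 i.2.1 i.2.2).1, i.2.1, regionGuard K i.2.2, (δ i.1 i.2.1 i.2.2).2⟩

/-- The complete deterministic automaton with the step function `δ`, whose third argument is the
index of a region, `2 * K + 1` standing for all the values above `K`. -/
noncomputable abbrev regionAutomaton (s₀ : S) : OneTA α where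
  State := S
  finite_state := inferInstance
  init := s₀
  trans := (Set.finite_range (regionTransition K δ)).toFinset
  final := F

theorem regionAutomaton_deterministic (s₀ : S) :
    (regionAutomaton K δ F s₀).Deterministic := by
  intro θ hθ θ' hθ' hne
  simp only [regionAutomaton, Set.Finite.mem_toFinset, Set.mem_range] at hθ hθ'
  obtain ⟨⟨s, a, i⟩, rfl⟩ := hθ
  obtain ⟨⟨s', a', i'⟩, rfl⟩ := hθ'
  by_cases hs : s = s'
  · by_cases ha : a = a'
    · right; right
      subst hs ha
      ext x
      simp only [regionTransition, Set.mem_inter_iff, mem_denote_regionGuard i.2,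
        mem_denote_regionGuard i'.2, Set.mem_empty_iff_false, iff_false, not_and]
      intro h h'
      apply hne
      rw [Fin.ext (h.symm.trans h')]
    · exact Or.inr (Or.inl ha)
  · exact Or.inl hs

theorem maxConst_regionAutomaton (s₀ : S) : (regionAutomaton K δ F s₀).maxConst ≤ K := by
  refine Finset.sup_le fun θ hθ => ?_
  simp only [regionAutomaton, Set.Finite.mem_toFinset, Set.mem_range] at hθ
  obtain ⟨i, rfl⟩ := hθ
  exact maxConst_regionGuard i.2.2.2

theorem cons_mem_regionAutomaton (s₀ s : S) (ν t : ℝ≥0) (a : α) (w : TimedWord α) (d : S × Bool)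
    (hd : δ s a (min (regionIndex (ν + t)) (2 * K + 1)) = d) :
    (t, a) :: w ∈ (regionAutomaton K δ F s₀).languageFrom s ν ↔
      w ∈ (regionAutomaton K δ F s₀).languageFrom d.1 (if d.2 then 0 else ν + t) := by
  rw [cons_mem_languageFrom]
  constructor
  · rintro ⟨θ, ⟨hθ, hs, ha, hg⟩, hw⟩
    simp only [regionAutomaton, Set.Finite.mem_toFinset, Set.mem_range] at hθ
    obtain ⟨⟨s', a', i⟩, rfl⟩ := hθ
    simp only [regionTransition] at hs ha hg
    subst hs ha hd
    rw [mem_denote_regionGuard i.2] at hg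
    rw [hg]
    exact hw
  · intro hw
    have hi : min (regionIndex (ν + t)) (2 * K + 1) < 2 * K + 2 := by omega
    refine ⟨regionTransition K δ (s, a, ⟨_, hi⟩), ⟨?_, rfl, rfl, ?_⟩, ?_⟩
    · simp only [regionAutomaton, Set.Finite.mem_toFinset, Set.mem_range]
      exact ⟨_, rfl⟩
    · simp only [regionTransition, mem_denote_regionGuard hi]
    · subst hd
      exact hw

end Region

/-! ### Configurations above the maximum constant -/

section Above

variable [Finite α] (A) (K : ℕ)

/-- The step function of an automaton that simulates `A` and whose Boolean component records that
the clock value of `A` exceeds `K`. -/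
noncomputable def aboveStep (s : Option A.State × Bool) (a : α) (i : ℕ) :
    (Option A.State × Bool) × Bool :=
  let d := A.next s.1 a (if s.2 then (K : ℝ≥0) + 1 else (i : ℝ≥0) / 2)
  ((d.1, s.2 && !d.2), d.2)

variable {A K}

/-- While the flag is set the simulation ignores its own clock and evaluates guards at `K + 1`, so
`μ` is arbitrary and every `ν` above `K` gives the same language. The first reset of `A` clears the
flag and resets the simulating clock too, after which the clocks agree. Taking `μ = 0` makes that
language recognizable. -/
theorem Deterministic.mem_aboveAutomaton (hA : A.Deterministic) (hK : A.maxConst ≤ K)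
    (s₀ : Option A.State × Bool) (w : TimedWord α) : ∀ q : Option A.State,
    haveI := A.finite_state
    (∀ ν : ℝ≥0, w ∈ (regionAutomaton K (A.aboveStep K)
        {s | [] ∈ A.optLanguage s.1 0} s₀).languageFrom (q, false) ν ↔ w ∈ A.optLanguage q ν) ∧
      ∀ ν μ : ℝ≥0, (K : ℝ≥0) < ν → (w ∈ (regionAutomaton K (A.aboveStep K)
        {s | [] ∈ A.optLanguage s.1 0} s₀).languageFrom (q, true) μ ↔
          w ∈ A.optLanguage q ν) := by
  have := A.finite_state
  induction w with
  | nil =>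
    intro q
    refine ⟨fun ν => ?_, fun ν μ _ => ?_⟩
    all_goals
      rw [nil_mem_languageFrom, A.nil_mem_optLanguage q ν 0]
      rfl
  | cons x w ih =>
    obtain ⟨t, a⟩ := x
    intro q
    have hlt : (K : ℝ≥0) < K + 1 := lt_add_one _
    refine ⟨fun ν => ?_, fun ν μ hν => ?_⟩
    · have e : A.next q a (((min (regionIndex (ν + t)) (2 * K + 1) : ℕ) : ℝ≥0) / 2) =
          A.next q a (ν + t) := next_congr hK (by rw [regionIndex_half]; omega) q a
      rw [cons_mem_regionAutomaton K _ _ s₀ (q, false) ν t a w _ rfl, hA.cons_mem_optLanguage]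
      simp only [aboveStep, Bool.false_eq_true, if_false, e, Bool.false_and]
      exact (ih _).1 _
    · have hν' : (K : ℝ≥0) < ν + t := hν.trans_le le_self_add
      have e : A.next q a ((K : ℝ≥0) + 1) = A.next q a (ν + t) :=
        next_congr hK (by rw [min_regionIndex_of_lt hlt, min_regionIndex_of_lt hν']) q a
      rw [cons_mem_regionAutomaton K _ _ s₀ (q, true) μ t a w _ rfl, hA.cons_mem_optLanguage]
      simp only [aboveStep, if_true, e, Bool.true_and]
      cases hb : (A.next q a (ν + t)).2
      · exact (ih _).2 _ _ hν'
      · exact (ih _).1 _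

theorem Deterministic.optLanguage_eq_of_lt (hA : A.Deterministic) (hK : A.maxConst ≤ K)
    (q : Option A.State) {ν μ : ℝ≥0} (hν : (K : ℝ≥0) < ν) (hμ : (K : ℝ≥0) < μ) :
    A.optLanguage q ν = A.optLanguage q μ := by
  ext w
  rw [← (hA.mem_aboveAutomaton hK (q, true) w q).2 ν 0 hν,
    ← (hA.mem_aboveAutomaton hK (q, true) w q).2 μ 0 hμ]

theorem Deterministic.isRecognizable_optLanguage_of_lt (hA : A.Deterministic)
    (hK : A.maxConst ≤ K) (q : Option A.State) {ν : ℝ≥0} (hν : (K : ℝ≥0) < ν) :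
    IsRecognizable (A.optLanguage q ν) := by
  have := A.finite_state
  refine ⟨_, regionAutomaton_deterministic K (A.aboveStep K) {s | [] ∈ A.optLanguage s.1 0}
    (q, true), ?_⟩
  ext w
  exact (hA.mem_aboveAutomaton hK (q, true) w q).2 ν 0 hν

end Above

/-! ### Time warps -/

/-- With the present at time 0, `-x'` is the moment of the last reset. The warp matches the moments
when the two clocks reach each integer, and monotonicity preserves the order of `t` relative to
them. -/
theorem regionIndex_warp {h : ℝ → ℝ} (hm : StrictMono h) (hp : ∀ s, h (s + 1) = h s + 1)
    {x x' t t' : ℝ≥0} (hx : h (-(x' : ℝ)) = -x) (ht : h t = t') :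
    regionIndex (x' + t) = regionIndex (x + t') := by
  have hn : ∀ n : ℕ, h (-(x' : ℝ) + n) = -x + n := by
    intro n
    induction n with
    | zero => simpa using hx
    | succ n ih =>
      push_cast
      rw [← add_assoc, hp, ih, add_assoc]
  refine regionIndex_eq_of_lt_iff (fun c => ?_) (fun c => ?_)
  · have := hm.lt_iff_lt (a := -(x' : ℝ) + c) (b := t)
    rw [hn, ht] at this
    rw [← NNReal.coe_lt_coe, ← NNReal.coe_lt_coe]
    push_cast
    constructor
    · intro h
      have := this.2 (by linarith)
      linarith
    · intro h
      have := this.1 (by linarith)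
      linarith
  · have := hm.lt_iff_lt (b := -(x' : ℝ) + c) (a := t)
    rw [hn, ht] at this
    rw [← NNReal.coe_lt_coe, ← NNReal.coe_lt_coe]
    push_cast
    constructor
    · intro h
      have := this.2 (by linarith)
      linarith
    · intro h
      have := this.1 (by linarith)
      linarith

/-- A strictly increasing map of the time axis that commutes with the shift by `1` and maps the
moments of the last resets of two clocks to those of two others turns every word into one on which
two automata behave in the same way. -/
theorem exists_warped_word {B : OneTA α} (hA : A.Deterministic) (hB : B.Deterministic)
    (w : TimedWord α) : ∀ (h : ℝ → ℝ) (_ : StrictMono h) (_ : ∀ s, h (s + 1) = h s + 1)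
    (_ : h 0 = 0) (q : Option A.State) (p : Option B.State) (x x' y y' : ℝ≥0)
    (_ : h (-(x' : ℝ)) = -x) (_ : h (-(y' : ℝ)) = -y),
    ∃ v : TimedWord α, (w ∈ A.optLanguage q x' ↔ v ∈ A.optLanguage q x) ∧
      (w ∈ B.optLanguage p y' ↔ v ∈ B.optLanguage p y) := by
  induction w with
  | nil =>
    intro _ _ _ _ q p x x' y y' _ _
    exact ⟨[], nil_mem_optLanguage _ _ _, nil_mem_optLanguage _ _ _⟩
  | cons z w ih =>
    obtain ⟨t, a⟩ := z
    intro h hm hp h0 q p x x' y y' hx hy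
    have hpos : 0 ≤ h t := by
      rw [← h0]
      exact hm.monotone t.2
    obtain ⟨t', ht⟩ : ∃ t' : ℝ≥0, h t = t' := ⟨⟨h t, hpos⟩, rfl⟩
    have eA := next_congr_of_regionIndex_eq (regionIndex_warp hm hp hx ht) q a
    have eB := next_congr_of_regionIndex_eq (regionIndex_warp hm hp hy ht) p a
    -- Moving the origin to the end of the delay replaces `h` by `s ↦ h (t + s) - h t`, which still
    -- matches the last resets, whether or not the transition resets.
    have key : ∀ (b : Bool) (z z' : ℝ≥0), h (-(z' : ℝ)) = -z →
        h (t + -((if b then 0 else z' + t : ℝ≥0) : ℝ)) - h t =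
          -((if b then 0 else z + t' : ℝ≥0) : ℝ) := by
      intro b z z' hz
      cases b
      · simp only [Bool.false_eq_true, if_false, NNReal.coe_add]
        rw [show (t : ℝ) + -(z' + t) = -z' by ring, hz, ht]
        ring
      · simp
    obtain ⟨v, hv₁, hv₂⟩ := ih (fun s => h (t + s) - h t)
      (fun s s' hs => sub_lt_sub_right (hm (by linarith)) _)
      (fun s => by rw [← add_assoc, hp]; ring) (by simp)
      (A.next q a (x' + t)).1 (B.next p a (y' + t)).1 _ _ _ _
      (key (A.next q a (x' + t)).2 x x' hx) (key (B.next p a (y' + t)).2 y y' hy)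
    refine ⟨(t', a) :: v, ?_, ?_⟩
    · rw [hA.cons_mem_optLanguage, hA.cons_mem_optLanguage, ← eA]
      exact hv₁
    · rw [hB.cons_mem_optLanguage, hB.cons_mem_optLanguage, ← eB]
      exact hv₂

end OneTA

/-- On the unit interval the homography `s ↦ k s / (k s + 1 - s)` fixes both endpoints and is
increasing for `k > 0`; `k` is solved from `b ↦ c`, and the integer part extends the map to the
line. -/
theorem exists_unit_warp {b c : ℝ} (hb : 0 < b) (hb' : b < 1) (hc : 0 < c) (hc' : c < 1) :
    ∃ h : ℝ → ℝ, StrictMono h ∧ (∀ s, h (s + 1) = h s + 1) ∧ h 0 = 0 ∧ h b = c := by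
  set k : ℝ := c * (1 - b) / (b * (1 - c)) with hk
  have hb1 : 0 < 1 - b := by linarith
  have hc1 : 0 < 1 - c := by linarith
  have hkpos : 0 < k := by positivity
  have hden : ∀ s : ℝ, 0 < k * Int.fract s + (1 - Int.fract s) := fun s => by
    have h1 := Int.fract_lt_one s
    have h2 := mul_nonneg hkpos.le (Int.fract_nonneg s)
    linarith
  refine ⟨fun s => ⌊s⌋ + k * Int.fract s / (k * Int.fract s + (1 - Int.fract s)), ?_, ?_, ?_, ?_⟩
  · intro s s' hs
    have h0 : 0 ≤ k * Int.fract s' / (k * Int.fract s' + (1 - Int.fract s')) :=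
      div_nonneg (mul_nonneg hkpos.le (Int.fract_nonneg _)) (hden _).le
    have h1 : k * Int.fract s / (k * Int.fract s + (1 - Int.fract s)) < 1 := by
      rw [div_lt_one (hden s)]
      linarith [Int.fract_lt_one s]
    rcases (Int.floor_mono hs.le).lt_or_eq with hlt | heq
    · have : (⌊s⌋ : ℝ) + 1 ≤ ⌊s'⌋ := by exact_mod_cast hlt
      simp only
      linarith
    · have hf : Int.fract s < Int.fract s' := by
        unfold Int.fract
        rw [heq]
        linarith
      simp only
      rw [heq]
      refine add_lt_add_right ?_ _
      rw [div_lt_div_iff₀ (hden s) (hden s')]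
      have := mul_lt_mul_of_pos_left hf hkpos
      linarith
  · intro s
    simp only [Int.floor_add_one, Int.fract_add_one]
    push_cast
    ring
  · simp
  · have h1 : ⌊b⌋ = 0 := Int.floor_eq_zero_iff.2 ⟨hb.le, hb'⟩
    have h2 : Int.fract b = b := Int.fract_eq_self.2 ⟨hb.le, hb'⟩
    simp only [h1, h2]
    rw [hk]
    field_simp
    push_cast
    ring

theorem exists_warp {x x' : ℝ≥0} (h : regionIndex x = regionIndex x') :
    ∃ h : ℝ → ℝ, StrictMono h ∧ (∀ s, h (s + 1) = h s + 1) ∧ h 0 = 0 ∧ h (-(x' : ℝ)) = -x := by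
  obtain ⟨n, hn⟩ : ∃ n, regionIndex x = 2 * n ∨ regionIndex x = 2 * n + 1 :=
    ⟨regionIndex x / 2, by omega⟩
  rcases hn with hn | hn
  · have e := (eq_natCast_iff_regionIndex n x).2 hn
    have e' := (eq_natCast_iff_regionIndex n x').2 (h.symm.trans hn)
    exact ⟨id, strictMono_id, fun _ => rfl, rfl, by rw [e, e']; rfl⟩
  · have bounds : ∀ y, regionIndex y = 2 * n + 1 → (n : ℝ) < y ∧ (y : ℝ) < n + 1 := by
      intro y hy
      have h1 := (natCast_lt_iff_regionIndex n y).2 (by omega)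
      have h2 := (lt_natCast_iff_regionIndex (n + 1) y).2 (by omega)
      rw [← NNReal.coe_lt_coe] at h1 h2
      push_cast at h1 h2
      exact ⟨h1, h2⟩
    obtain ⟨h1, h2⟩ := bounds x hn
    obtain ⟨h1', h2'⟩ := bounds x' (h.symm.trans hn)
    -- These are the fractional parts of `-x'` and `-x`; shifting back by `n + 1` gives the required
    -- value.
    obtain ⟨f, hm, hp, h0, hf⟩ := exists_unit_warp (b := n + 1 - x') (c := n + 1 - x)
      (by linarith) (by linarith) (by linarith) (by linarith)
    refine ⟨f, hm, hp, h0, ?_⟩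
    have hN : ∀ m : ℕ, f (-(x' : ℝ) + m) = f (-(x' : ℝ)) + m := by
      intro m
      induction m with
      | zero => simp
      | succ m ih =>
        push_cast
        rw [← add_assoc, hp, ih, add_assoc]
    have := hN (n + 1)
    push_cast at this
    rw [show -(x' : ℝ) + (n + 1) = n + 1 - x' by ring, hf] at this
    linarith

variable {α : Type u}

/-- If the language accepted from a configuration is recognizable, then it does not depend on the
clock value within its region. -/
theorem OneTA.Deterministic.optLanguage_eq_of_isRecognizable {A : OneTA α} (hA : A.Deterministic)
    (q : Option A.State) {x x' : ℝ≥0} (h : regionIndex x = regionIndex x')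
    (hr : IsRecognizable (A.optLanguage q x)) : A.optLanguage q x' = A.optLanguage q x := by
  obtain ⟨B, hB, hBL⟩ := hr
  obtain ⟨f, hm, hp, h0, hf⟩ := exists_warp h
  ext w
  obtain ⟨v, hv₁, hv₂⟩ := exists_warped_word hA hB w f hm hp h0 q (some B.init) x x' 0 0 hf
    (by simpa using h0)
  change B.optLanguage (some B.init) 0 = _ at hBL
  rw [hBL] at hv₂
  exact hv₁.trans hv₂.symm

/-! ### The syntactic profile -/

theorem syntacticReset_eq_zero {L : TimedLanguage α} {w : TimedWord α}
    (h : IsRecognizable (residual w L)) : syntacticReset L w = 0 := by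
  cases w using List.reverseRecOn with
  | nil => exact syntacticReset_nil L
  | append_singleton w x =>
    obtain ⟨t, a⟩ := x
    rw [syntacticReset_snoc, if_pos h]

theorem residual_nil (L : TimedLanguage α) : residual [] L = L := rfl

theorem mem_iff_nil_mem_residual (L : TimedLanguage α) (w : TimedWord α) :
    w ∈ L ↔ [] ∈ residual w L := by
  simp [residual]

theorem hi_add_normalForm_delay (r t : ℝ≥0) : hi r + (hi (r + t) - hi r) = hi (r + t) :=
  add_tsub_cancel_of_le (hi_mono le_self_add)

/-- The automaton depends on `w`: each time the residual becomes recognizable, it is exchanged for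
one accepting that residual from clock value 0, so that its clock keeps following the syntactic
reset function. -/
theorem exists_residual_normalForm {L : TimedLanguage α} (hL : IsRecognizable L)
    (w : TimedWord α) : ∃ B : OneTA α, B.Deterministic ∧ ∃ p : Option B.State,
      residual w L = B.optLanguage p (syntacticReset L w) ∧
      residual (normalForm (syntacticReset L) w) L = B.optLanguage p (hi (syntacticReset L w)) ∧
      syntacticReset L (normalForm (syntacticReset L) w) = hi (syntacticReset L w) := by
  induction w using List.reverseRecOn with
  | nil =>
    obtain ⟨A, hA, rfl⟩ := hL
    refine ⟨A, hA, some A.init, ?_, ?_, ?_⟩ <;>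
      simp only [normalForm_nil, syntacticReset_nil, hi_zero, residual_nil] <;> rfl
  | append_singleton w x ih =>
    obtain ⟨t, a⟩ := x
    obtain ⟨B, hB, p, h1, h2, h3⟩ := ih
    have r1 := hB.residual_snoc h1 t a
    have r2 := hB.residual_snoc h2 (hi (syntacticReset L w + t) - hi (syntacticReset L w)) a
    rw [hi_add_normalForm_delay, OneTA.next_congr_of_regionIndex_eq (regionIndex_hi _)] at r2
    rw [← normalForm_snoc] at r2
    generalize B.next p a (syntacticReset L w + t) = d at r1 r2
    have of_eq : residual (w ++ [(t, a)]) L =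
          residual (normalForm (syntacticReset L) (w ++ [(t, a)])) L →
        IsRecognizable (residual (w ++ [(t, a)]) L) →
        ∃ B : OneTA α, B.Deterministic ∧ ∃ p : Option B.State,
          residual (w ++ [(t, a)]) L = B.optLanguage p (syntacticReset L (w ++ [(t, a)])) ∧
          residual (normalForm (syntacticReset L) (w ++ [(t, a)])) L =
            B.optLanguage p (hi (syntacticReset L (w ++ [(t, a)]))) ∧
          syntacticReset L (normalForm (syntacticReset L) (w ++ [(t, a)])) =
            hi (syntacticReset L (w ++ [(t, a)])) := by
      intro he hr
      have hr' := hr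
      rw [he] at hr'
      rw [syntacticReset_eq_zero hr, syntacticReset_eq_zero hr', hi_zero, ← he]
      obtain ⟨C, hC, hCL⟩ := hr
      exact ⟨C, hC, some C.init, hCL.symm, hCL.symm, rfl⟩
    obtain ⟨q, b⟩ := d
    cases b
    · simp only [Bool.false_eq_true, if_false] at r1 r2
      have hidx := regionIndex_hi (syntacticReset L w + t)
      by_cases hr : IsRecognizable (residual (w ++ [(t, a)]) L)
      · refine of_eq ?_ hr
        rw [r1] at hr ⊢
        rw [r2, hB.optLanguage_eq_of_isRecognizable q hidx.symm hr]
      -- Region invariance, applied from the normal form back to the word, rules out that only the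
      -- former has a recognizable residual.
      · by_cases hr' : IsRecognizable (residual (normalForm (syntacticReset L) (w ++ [(t, a)])) L)
        · exfalso
          apply hr
          rw [r2] at hr'
          rwa [r1, hB.optLanguage_eq_of_isRecognizable q hidx hr']
        · refine ⟨B, hB, q, ?_, ?_, ?_⟩
          · rw [syntacticReset_snoc, if_neg hr, r1]
          · rw [syntacticReset_snoc, if_neg hr, r2]
          · rw [syntacticReset_snoc, if_neg hr]
            rw [normalForm_snoc] at hr' ⊢
            rw [syntacticReset_snoc, if_neg hr', h3, hi_add_normalForm_delay]
    · simp only [if_true] at r1 r2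
      exact of_eq (r1.trans r2.symm) (r1 ▸ hB.isRecognizable_optLanguage_zero q)

theorem syntacticReset_normalForm {L : TimedLanguage α} (hL : IsRecognizable L)
    (w : TimedWord α) :
    syntacticReset L (normalForm (syntacticReset L) w) = hi (syntacticReset L w) := by
  obtain ⟨_, _, _, _, _, h⟩ := exists_residual_normalForm hL w
  exact h

theorem mem_iff_normalForm_mem {L : TimedLanguage α} (hL : IsRecognizable L) (w : TimedWord α) :
    w ∈ L ↔ normalForm (syntacticReset L) w ∈ L := by
  obtain ⟨B, _, p, h1, h2, _⟩ := exists_residual_normalForm hL w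
  rw [mem_iff_nil_mem_residual, mem_iff_nil_mem_residual L (normalForm _ _), h1, h2]
  exact B.nil_mem_optLanguage _ _ _

theorem syntacticProfile_preserves {L : TimedLanguage α} (hL : IsRecognizable L) :
    (syntacticProfile L).Preserves L := by
  refine ⟨fun v w h => ?_, mem_iff_normalForm_mem hL⟩
  rw [mem_iff_nil_mem_residual, mem_iff_nil_mem_residual L w.1, h.2]

theorem syntacticProfile_equiv_snoc {L : TimedLanguage α} {v w : HIWord α}
    (h : (syntacticProfile L).equiv v w) (n : ℕ) (a : α) :
    (syntacticProfile L).equiv (v.snoc n a) (w.snoc n a) := by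
  obtain ⟨h1, h2⟩ := h
  have e : residual (v.snoc n a).1 L = residual (w.snoc n a).1 L := by
    ext x
    have := Set.ext_iff.1 h2 (((n : ℝ≥0) / 2, a) :: x)
    simpa [residual, HIWord.snoc] using this
  refine ⟨?_, e⟩
  simp only [HIWord.snoc] at e ⊢
  rw [syntacticReset_snoc, syntacticReset_snoc, e, h1]

theorem syntacticProfile_monotonic {L : TimedLanguage α} (hL : IsRecognizable L) :
    (syntacticProfile L).Monotonic := by
  refine ⟨fun v w h => ⟨Or.inl ?_, syntacticProfile_equiv_snoc h⟩, fun w => ?_⟩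
  · rw [regionEquiv_iff_regionIndex]
    exact congrArg _ h.1
  · change RegionEquiv (syntacticReset L w) (syntacticReset L (normalForm (syntacticReset L) w))
    rw [syntacticReset_normalForm hL]
    exact hi_regionEquiv _

/-- A reset of `A` leaves a recognizable residual, so the syntactic reset function resets then as
well; it may reset more often, whence the inequality. -/
theorem exists_residual_eq_optLanguage {A : OneTA α} (hA : A.Deterministic) (w : TimedWord α) :
    ∃ (q : Option A.State) (ν : ℝ≥0), residual w A.language = A.optLanguage q ν ∧
      syntacticReset A.language w ≤ ν ∧ (IsHalfIntegral w → ∃ m : ℕ, ν = (m : ℝ≥0) / 2) := by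
  induction w using List.reverseRecOn with
  | nil =>
    exact ⟨some A.init, 0, rfl, (syntacticReset_nil _).le, fun _ => ⟨0, by simp⟩⟩
  | append_singleton w x ih =>
    obtain ⟨t, a⟩ := x
    obtain ⟨q, ν, h1, h2, h3⟩ := ih
    have r1 := hA.residual_snoc h1 t a
    refine ⟨_, _, r1, ?_, fun hw => ?_⟩
    · cases hb : (A.next q a (ν + t)).2
      · rw [if_neg Bool.false_ne_true]
        rcases (syntacticReset_isResetFunction A.language).2 w t a with h | h <;> rw [h]
        · exact zero_le
        · exact add_le_add_left h2 t
      · rw [hb, if_pos rfl] at r1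
        rw [syntacticReset_eq_zero (r1 ▸ hA.isRecognizable_optLanguage_zero _)]
        exact zero_le
    · split_ifs
      · exact ⟨0, by simp⟩
      · obtain ⟨m, hm⟩ := h3 fun x hx => hw x (List.mem_append_left _ hx)
        obtain ⟨n, hn⟩ := hw (t, a) (by simp)
        refine ⟨m + n, ?_⟩
        simp only at hn
        rw [hm, hn]
        push_cast
        ring

theorem exists_syntacticReset_eq_half (L : TimedLanguage α) (w : TimedWord α)
    (hw : IsHalfIntegral w) : ∃ m : ℕ, syntacticReset L w = (m : ℝ≥0) / 2 := by
  induction w using List.reverseRecOn with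
  | nil => exact ⟨0, by simp [syntacticReset_nil]⟩
  | append_singleton w x ih =>
    obtain ⟨t, a⟩ := x
    rw [syntacticReset_snoc]
    split_ifs
    · exact ⟨0, by simp⟩
    · obtain ⟨m, hm⟩ := ih fun x hx => hw x (List.mem_append_left _ hx)
      obtain ⟨n, hn⟩ := hw (t, a) (by simp)
      refine ⟨m + n, ?_⟩
      simp only at hn
      rw [hm, hn]
      push_cast
      ring

theorem isHalfIntegral_normalForm (R : TimedWord α → ℝ≥0) (w : TimedWord α) :
    IsHalfIntegral (normalForm R w) := by
  induction w using List.reverseRecOn with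
  | nil =>
    rw [normalForm_nil]
    intro x hx
    simp at hx
  | append_singleton w x ih =>
    obtain ⟨t, a⟩ := x
    rw [normalForm_snoc]
    intro x hx
    rcases List.mem_append.1 hx with h | h
    · exact ih x h
    · rw [List.mem_singleton.1 h]
      exact (normalForm_delay_spec _ _).1

/-- The normal form of a word under the syntactic reset function, as a half-integral word. -/
noncomputable def syntacticNormalForm (L : TimedLanguage α) (w : TimedWord α) : HIWord α :=
  ⟨normalForm (syntacticReset L) w, isHalfIntegral_normalForm _ _⟩

/-- Up to `≈`, an extension depends on the new clock value only through its truncated region index,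
which is what guards with constants up to `K` can test. -/
theorem syntacticNormalForm_snoc_equiv {L : TimedLanguage α} (hL : IsRecognizable L) {K : ℕ}
    (hK : (syntacticProfile L).C K) (w : TimedWord α) (t : ℝ≥0) (a : α) :
    (syntacticProfile L).equiv (syntacticNormalForm L (w ++ [(t, a)]))
      ((syntacticNormalForm L w).snoc (min (regionIndex (syntacticReset L w + t)) (2 * K + 1) -
        regionIndex (syntacticReset L w)) a) := by
  have hR : (syntacticProfile L).R (syntacticNormalForm L w).1 =
      (regionIndex (syntacticReset L w) : ℝ≥0) / 2 := by
    rw [← hi_eq_regionIndex]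
    exact syntacticReset_normalForm hL w
  have hle : regionIndex (syntacticReset L w) ≤ regionIndex (syntacticReset L w + t) := by
    have := hi_mono (le_self_add : syntacticReset L w ≤ syntacticReset L w + t)
    rw [hi_eq_regionIndex, hi_eq_regionIndex,
      div_le_div_iff_of_pos_right (by norm_num : (0 : ℝ≥0) < 2)] at this
    exact_mod_cast this
  have e : syntacticNormalForm L (w ++ [(t, a)]) = (syntacticNormalForm L w).snoc
      (regionIndex (syntacticReset L w + t) - regionIndex (syntacticReset L w)) a := by
    apply Subtype.ext
    simp only [syntacticNormalForm, HIWord.snoc, normalForm_snoc]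
    rw [hi_eq_regionIndex, hi_eq_regionIndex]
    obtain ⟨d, hd⟩ := Nat.exists_eq_add_of_le hle
    rw [hd, Nat.add_sub_cancel_left]
    push_cast
    rw [add_div, add_tsub_cancel_left]
  have lt_of : ∀ n : ℕ, 2 * K < regionIndex (syntacticReset L w) + n →
      (K : ℝ≥0) < (syntacticProfile L).R (syntacticNormalForm L w).1 + (n : ℝ≥0) / 2 := by
    intro n hn
    rw [hR, ← add_div, ← Nat.cast_add, natCast_lt_iff_regionIndex, regionIndex_half]
    exact hn
  rw [e]
  rcases le_or_gt (regionIndex (syntacticReset L w + t)) (2 * K) with h | h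
  · rw [min_eq_left (by omega)]
  · rw [min_eq_right (by omega)]
    -- Both delays lead above `K`, so both words are equivalent to the extension by `K + 1/2`. This
    -- includes the case where the truncated subtraction gives delay 0 because the clock is already
    -- above `K`.
    exact (syntacticProfile L).equiv.trans' (hK _ a _ (lt_of _ (by omega)))
      ((syntacticProfile L).equiv.symm' (hK _ a _ (lt_of _ (by omega))))

/-! ### Finite index and the least constant -/

section Finite

variable [Finite α]

theorem finite_quotient_syntacticProfile {L : TimedLanguage α} (hL : IsRecognizable L) :
    Finite (Quotient (syntacticProfile L).equiv) := by
  obtain ⟨A, hA, rfl⟩ := hL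
  have := A.finite_state
  set K := A.maxConst
  -- Doubled values of `R` and of the clock of `A`: up to `2 * K` they are exact, and `2 * K + 2`
  -- stands for any clock value above `K`, where `R` is 0.
  let I := Option A.State × Fin (2 * K + 3) × Fin (2 * K + 3)
  let g : I → ℝ≥0 × TimedLanguage α := fun i =>
    ((i.2.1 : ℕ) / 2, A.optLanguage i.1 (((i.2.2 : ℕ) : ℝ≥0) / 2))
  have half : ∀ m : ℕ, ¬ (K : ℝ≥0) < (m : ℝ≥0) / 2 → m < 2 * K + 3 := by
    intro m hm
    rw [natCast_lt_iff_regionIndex, regionIndex_half] at hm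
    omega
  have hg : ∀ w : HIWord α, ∃ i : I,
      g i = (syntacticReset A.language w.1, residual w.1 A.language) := by
    intro w
    obtain ⟨q, ν, h1, h2, h3⟩ := exists_residual_eq_optLanguage hA w.1
    obtain ⟨m, rfl⟩ := h3 w.2
    obtain ⟨r, hr⟩ := exists_syntacticReset_eq_half A.language w.1 w.2
    by_cases hm : (K : ℝ≥0) < (m : ℝ≥0) / 2
    · have hrec := hA.isRecognizable_optLanguage_of_lt le_rfl q hm
      have hK : (K : ℝ≥0) < ((2 * K + 2 : ℕ) : ℝ≥0) / 2 := by
        rw [natCast_lt_iff_regionIndex, regionIndex_half]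
        omega
      refine ⟨(q, ⟨0, by omega⟩, ⟨2 * K + 2, by omega⟩), ?_⟩
      rw [h1, syntacticReset_eq_zero (h1 ▸ hrec), hA.optLanguage_eq_of_lt le_rfl q hm hK]
      simp [g]
    · rw [hr] at h2
      refine ⟨(q, ⟨r, half r fun h => hm (h.trans_le h2)⟩, ⟨m, half m hm⟩), ?_⟩
      rw [hr, h1]
  choose i hi using hg
  refine Finite.of_injective (β := I) (fun c => i c.out) fun c c' h => ?_
  have e := (hi c.out).symm.trans ((congrArg g h).trans (hi c'.out))
  rw [Prod.mk.injEq] at e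
  exact Quotient.out_equiv_out.1 e

/-- Since `R` bounds the clock of `A` from below, both delays bring that clock above the maximum
constant. They fire the same transition and leave the same recognizable residual, where `R` is 0. -/
theorem syntacticProfile_C {A : OneTA α} (hA : A.Deterministic) :
    (syntacticProfile A.language).C A.maxConst := by
  intro w a n h
  change (A.maxConst : ℝ≥0) < syntacticReset A.language w.1 + n / 2 at h
  obtain ⟨q, ν, h1, h2, -⟩ := exists_residual_eq_optLanguage hA w.1
  have hn : (A.maxConst : ℝ≥0) < ν + n / 2 := h.trans_le (add_le_add_left h2 _)
  have hK : (A.maxConst : ℝ≥0) < ν + ((2 * A.maxConst + 1 : ℕ) : ℝ≥0) / 2 := by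
    refine lt_of_lt_of_le ?_ le_add_self
    rw [natCast_lt_iff_regionIndex, regionIndex_half]
    omega
  have r1 := hA.residual_snoc h1 (n / 2) a
  have r2 := hA.residual_snoc h1 (((2 * A.maxConst + 1 : ℕ) : ℝ≥0) / 2) a
  rw [OneTA.next_congr le_rfl
    ((min_regionIndex_of_lt hK).trans (min_regionIndex_of_lt hn).symm) q a] at r2
  generalize A.next q a (ν + n / 2) = d at r1 r2
  obtain ⟨p, b⟩ := d
  have key : residual (w.snoc n a).1 A.language =
        residual (w.snoc (2 * A.maxConst + 1) a).1 A.language ∧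
      IsRecognizable (residual (w.snoc n a).1 A.language) := by
    simp only [HIWord.snoc]
    rw [r1, r2]
    cases b
    · exact ⟨hA.optLanguage_eq_of_lt le_rfl p hn hK,
        hA.isRecognizable_optLanguage_of_lt le_rfl p hn⟩
    · exact ⟨rfl, hA.isRecognizable_optLanguage_zero p⟩
  refine ⟨?_, key.1⟩
  rw [syntacticReset_eq_zero key.2, syntacticReset_eq_zero (key.1 ▸ key.2)]

theorem minConstant_le_of_C {L : TimedLanguage α} (hL : IsRecognizable L) {K : ℕ}
    (hK : (syntacticProfile L).C K) : minConstant L ≤ K := by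
  have := finite_quotient_syntacticProfile hL
  obtain ⟨n, ⟨e⟩⟩ := Finite.exists_equiv_fin (Quotient (syntacticProfile L).equiv)
  let cls : TimedWord α → Fin n := fun w => e (Quotient.mk _ (syntacticNormalForm L w))
  -- On the representative, `R` is half its region index, so this delay brings the clock to the
  -- region of index `i` when that is not already behind.
  let tgt : Fin n → α → ℕ → HIWord α := fun s a i =>
    (e.symm s).out.snoc (i - regionIndex (syntacticReset L (e.symm s).out.1)) a
  classical
  let δ : Fin n → α → ℕ → Fin n × Bool := fun s a i =>
    (e (Quotient.mk _ (tgt s a i)), decide (syntacticReset L (tgt s a i).1 = 0))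
  have hout : ∀ w, (syntacticProfile L).equiv (e.symm (cls w)).out (syntacticNormalForm L w) := by
    intro w
    simp only [cls, Equiv.symm_apply_apply]
    exact Quotient.mk_out (s := (syntacticProfile L).equiv) _
  have hδ : ∀ (w : TimedWord α) (t : ℝ≥0) (a : α),
      δ (cls w) a (min (regionIndex (syntacticReset L w + t)) (2 * K + 1)) =
        (cls (w ++ [(t, a)]), decide (syntacticReset L (w ++ [(t, a)]) = 0)) := by
    intro w t a
    have h0 : regionIndex (syntacticReset L (e.symm (cls w)).out.1) =
        regionIndex (syntacticReset L w) := by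
      rw [(hout w).1, ← regionIndex_hi (syntacticReset L w), ← syntacticReset_normalForm hL]
      rfl
    have h1 : (syntacticProfile L).equiv
        (tgt (cls w) a (min (regionIndex (syntacticReset L w + t)) (2 * K + 1)))
        (syntacticNormalForm L (w ++ [(t, a)])) := by
      refine (syntacticProfile L).equiv.trans' ?_
        ((syntacticProfile L).equiv.symm' (syntacticNormalForm_snoc_equiv hL hK w t a))
      simp only [tgt]
      rw [h0]
      exact syntacticProfile_equiv_snoc (hout w) _ a
    have h2 : syntacticReset L (syntacticNormalForm L (w ++ [(t, a)])).1 = 0 ↔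
        syntacticReset L (w ++ [(t, a)]) = 0 := by
      simp only [syntacticNormalForm]
      rw [syntacticReset_normalForm hL]
      constructor
      · intro h
        have := congrArg regionIndex h
        rw [regionIndex_hi, regionIndex_zero] at this
        exact eq_zero_of_regionIndex this
      · intro h
        rw [h, hi_zero]
    simp only [δ, cls, Prod.mk.injEq]
    refine ⟨congrArg e (Quotient.sound h1), ?_⟩
    rw [decide_eq_decide, h1.1]
    exact h2
  let F : Set (Fin n) := {s | (e.symm s).out.1 ∈ L}
  -- Invariant: after `w` the automaton is in the class of the normal form of `w`, with clock value
  -- exactly `R(w)`.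
  have main : ∀ v w : TimedWord α,
      v ∈ (OneTA.regionAutomaton K δ F (cls [])).languageFrom (cls w) (syntacticReset L w) ↔ w ++ v ∈ L := by
    intro v
    induction v with
    | nil =>
      intro w
      rw [OneTA.nil_mem_languageFrom, List.append_nil, mem_iff_normalForm_mem hL]
      exact (syntacticProfile_preserves hL).1 _ _ (hout w)
    | cons x v ih =>
      obtain ⟨t, a⟩ := x
      intro w
      rw [OneTA.cons_mem_regionAutomaton K δ F _ _ _ _ _ _ _ (hδ w t a)]
      -- Resetting whenever `R` vanishes is harmless even if `R` was not reset there: the clock is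
      -- then 0 anyway.
      have hclock : (if decide (syntacticReset L (w ++ [(t, a)]) = 0) then 0
          else syntacticReset L w + t) = syntacticReset L (w ++ [(t, a)]) := by
        rcases (syntacticReset_isResetFunction L).2 w t a with h | h
        · simp [h]
        · by_cases h' : syntacticReset L (w ++ [(t, a)]) = 0
          · simp [h']
          · rw [decide_eq_false h', if_neg Bool.false_ne_true, h]
      simp only
      rw [hclock]
      refine (ih (w ++ [(t, a)])).trans ?_
      simp
  have hlang : (OneTA.regionAutomaton K δ F (cls [])).language = L := by
    ext v
    have := main v []
    rw [syntacticReset_nil] at this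
    exact this
  exact (Nat.sInf_le (s := {K : ℕ | ∃ A : OneTA α,
    A.Deterministic ∧ A.maxConst = K ∧ A.language = L})
    ⟨_, OneTA.regionAutomaton_deterministic K δ F _, rfl, hlang⟩).trans
    (OneTA.maxConst_regionAutomaton K δ F (cls []))

theorem constant_syntacticProfile {L : TimedLanguage α} (hL : IsRecognizable L) :
    (syntacticProfile L).constant = (minConstant L : ℕ∞) := by
  refine le_antisymm ?_ (le_iInf₂ fun K hK => by exact_mod_cast minConstant_le_of_C hL hK)
  obtain ⟨A, hA, hAL⟩ := hL
  obtain ⟨B, hB, hBK, hBL⟩ := Nat.sInf_mem (s := {K : ℕ | ∃ A : OneTA α,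
    A.Deterministic ∧ A.maxConst = K ∧ A.language = L}) ⟨_, A, hA, rfl, hAL⟩
  refine iInf₂_le (minConstant L) ?_
  change (syntacticProfile L).C (sInf _)
  rw [← hBK, ← hBL]
  exact syntacticProfile_C hB

end Finite

end OneClock

theorem mainTheorem4 {α : Type*} [Finite α] (L : OneClock.TimedLanguage α)
    (hL : OneClock.IsRecognizable L) :
    (OneClock.syntacticProfile L).Preserves L ∧
      (OneClock.syntacticProfile L).Monotonic ∧
      (OneClock.syntacticProfile L).FiniteIndex ∧
      (OneClock.syntacticProfile L).constant = (OneClock.minConstant L : ℕ∞) := by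
  have hc := OneClock.constant_syntacticProfile hL
  exact ⟨OneClock.syntacticProfile_preserves hL, OneClock.syntacticProfile_monotonic hL,
    ⟨OneClock.finite_quotient_syntacticProfile hL, hc ▸ ENat.natCast_lt_top _⟩, hc⟩
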